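/- Let $S^m$ be the Euclidean space of real symmetric $m\times m$ matrices with $\langle Y,D\rangle=\operatorname{tr}(YD)$, let $S^m_+$ be the cone of positive-semidefinite matrices, $\delta_{S^m_+}$ its indicator function ($0$ on $S^m_+$, $+\infty$ elsewhere), and $\Pi_{S^m_+}=\operatorname{Prox}_{\delta_{S^m_+}}$ the metric projection onto it. For a Lipschitz map $S$ of a Euclidean space into itself, the limiting Jacobian $\overline\nabla S(x)$ is the set of all limits of derivatives $S'(x^k)$ along sequences $x^k\to x$ of points at which $S$ is differentiable, and $JS(x)$ is the convex hull of $\overline\nabla S(x)$. We say that a function $r:E\to(-\infty,\infty]$ on a Euclidean space $E$ satisfies Assumption 2 at $\bar x$ for $\bar u$ if $r$ is lower semicontinuous, proper and convex, $\bar x\in\operatorname{dom}r$, $\bar u\in\partial r(\bar x)$ (limiting subdifferential), and there is $\overline W\in\overline\nabla\operatorname{Prox}_r(\bar x+\bar u)$ such that $$\bigcup_{W\in J\operatorname{Prox}_r(\bar x+\bar u)}\operatorname{rge}W=\operatorname{rge}\overline W,$$ and such that for every $y$ in this union there is $\bar z$ with $y=\overline W\bar z$ and $$\langle y,\bar z-y\rangle=\min\{\langle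 y,z-y\rangle : z\in E,\ W\in J\operatorname{Prox}_r(\bar x+\bar u),\ y=Wz\}.$$ Let $X\in S^m_+$ and $U\in\mathcal N_{S^m_+}(X)$ (limiting normal cone). Then $\delta_{S^m_+}$ satisfies Assumption 2 at $X$ for $U$. Moreover, let $X+U=P\Lambda P^T$ with $P$ orthogonal and $\Lambda=\operatorname{Diag}(\sigma_1,\dots,\sigma_m)$, and put $\alpha=\{i:\sigma_i>0\}$, $\beta=\{i:\sigma_i=0\}$, $\gamma=\{i:\sigma_i<0\}$, $\widetilde D=P^TDP$ for $D\in S^m$, and $$\Sigma_{ij}=\frac{\max\{\sigma_i,0\}+\max\{\sigma_j,0\}}{|\sigma_i|+|\sigma_j|}\quad(0/0:=1).$$ Then the following hold. (a) The identity map of $S^{|\beta|}$ belongs to $\overline\nabla\Pi_{S^{|\beta|}_+}(0)$, and there is $\overline W\in\overline\nabla\Pi_{S^m_+}(X+U)$ given, for all $D\in S^m$, by $$\overline WD=P\begin{pmatrix}\widetilde D_{\alpha\alpha}&\widetilde D_{\alpha\beta}&\Sigma_{\alpha\gamma}\circ\widetilde D_{\alpha\gamma}\\ \widetilde D_{\beta\alpha}&\widetilde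 D_{\beta\beta}&0\\ \Sigma_{\gamma\alpha}\circ\widetilde D_{\gamma\alpha}&0&0\end{pmatrix}P^T,$$ where $\circ$ is the entrywise product. (b) For this $\overline W$, the union $\bigcup_{W\in J\Pi_{S^m_+}(X+U)}\operatorname{rge}W$ is equal to $\operatorname{rge}\overline W$, that is, to the set of all matrices of the form displayed in (a) with $D\in S^m$. (c) For every $Y$ in this union, with $\widetilde Y=P^TYP$, there is $\overline D\in S^m$ with $Y=\overline W\,\overline D$ such that $P^T\overline DP=(d_{ij})$ satisfies $$d_{ij}=\widetilde Y_{ij}\ \ (i,j\in\alpha\cup\beta),\qquad d_{ij}=d_{ji}=\frac{\sigma_i-\sigma_j}{\sigma_i}\widetilde Y_{ij}\ \ (i\in\alpha,\ j\in\gamma),$$ and $$\langle Y,\overline D-Y\rangle=\min\{\langle Y,D-Y\rangle : D\in S^m,\ W\in J\Pi_{S^m_+}(X+U),\ Y=WD\}=-2\sum_{i\in\alpha,\,j\in\gamma}\frac{\sigma_j}{\sigma_i}\widetilde Y_{ij}^2 .$$ -/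

import Mathlib

open scoped Topology Matrix

noncomputable section

/-! ### Extended-real-valued functions and proximal mappings -/

section VariationalAnalysis

variable {E : Type*} [NormedAddCommGroup E] [InnerProductSpace ℝ E]

/-- The effective domain `dom r`. -/
def effDomain (r : E → EReal) : Set E := {x | r x < ⊤}

/-- The epigraph of `r`, a subset of `E × ℝ`. -/
def epigraph (r : E → EReal) : Set (E × ℝ) := {p | r p.1 ≤ (p.2 : EReal)}

/-- `r` is proper: nonempty effective domain, and the value `-∞` is not taken. -/
def IsProperFun (r : E → EReal) : Prop := (effDomain r).Nonempty ∧ ∀ x, r x ≠ ⊥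

/-- The regular (Fréchet) subdifferential: `r x' ≥ r x + ⟪y, x' - x⟫ + o(‖x' - x‖)`, for `x ∈ dom r`. -/
def regularSubdifferential (r : E → EReal) (x : E) : Set E :=
  {y | x ∈ effDomain r ∧ ∀ ε : ℝ, 0 < ε → ∀ᶠ x' in 𝓝 x,
    r x + ((inner ℝ y (x' - x) - ε * ‖x' - x‖ : ℝ) : EReal) ≤ r x'}

/-- The limiting (Mordukhovich) subdifferential at a point of the effective domain. -/
def limitingSubdifferential (r : E → EReal) (x : E) : Set E :=
  {y | x ∈ effDomain r ∧ ∃ xs ys : ℕ → E,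
    Filter.Tendsto xs Filter.atTop (𝓝 x) ∧
    Filter.Tendsto (fun k => r (xs k)) Filter.atTop (𝓝 (r x)) ∧
    (∀ k, ys k ∈ regularSubdifferential r (xs k)) ∧
    Filter.Tendsto ys Filter.atTop (𝓝 y)}

/-- `p` minimizes `u ↦ r u + ½‖u - x‖²`. -/
def IsProxPoint (r : E → EReal) (x p : E) : Prop :=
  ∀ u, r p + ((1 / 2 * ‖p - x‖ ^ 2 : ℝ) : EReal) ≤ r u + ((1 / 2 * ‖u - x‖ ^ 2 : ℝ) : EReal)

/-- The proximal mapping `Prox_r`, as a function: the minimizer of `u ↦ r u + ½‖u - x‖²`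
(which exists and is unique for `r` proper, lower semicontinuous and convex). -/
def proxMap (r : E → EReal) (x : E) : E :=
  Classical.epsilon (fun p => IsProxPoint r x p)

/-- The metric projection `Π_C`, as a function: the point of `C` nearest to `x`
(which exists and is unique for `C` nonempty, closed and convex). -/
def metricProj (C : Set E) (x : E) : E :=
  Classical.epsilon (fun p => p ∈ C ∧ ∀ q ∈ C, ‖x - p‖ ≤ ‖x - q‖)

open Classical in
/-- The indicator function `δ_C`. -/
def indicatorFun (C : Set E) (x : E) : EReal := if x ∈ C then 0 else ⊤

/-- The regular (Fréchet) normal cone to `C` at `x ∈ C`. -/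
def regularNormalCone (C : Set E) (x : E) : Set E :=
  {y | x ∈ C ∧ ∀ ε : ℝ, 0 < ε → ∀ᶠ x' in 𝓝[C] x, inner ℝ y (x' - x) ≤ ε * ‖x' - x‖}

/-- The limiting (Mordukhovich) normal cone to `C` at `x ∈ C`. -/
def limitingNormalCone (C : Set E) (x : E) : Set E :=
  {y | x ∈ C ∧ ∃ xs ys : ℕ → E,
    Filter.Tendsto xs Filter.atTop (𝓝 x) ∧
    (∀ k, xs k ∈ C ∧ ys k ∈ regularNormalCone C (xs k)) ∧
    Filter.Tendsto ys Filter.atTop (𝓝 y)}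

/-- The limiting Jacobian of `S` at `x`: limits of derivatives of `S` along sequences of points of
differentiability that converge to `x`. -/
def limitingJacobian (S : E → E) (x : E) : Set (E →L[ℝ] E) :=
  {V | ∃ xs : ℕ → E,
    (∀ k, DifferentiableAt ℝ S (xs k)) ∧
    Filter.Tendsto xs Filter.atTop (𝓝 x) ∧
    Filter.Tendsto (fun k => fderiv ℝ S (xs k)) Filter.atTop (𝓝 V)}

/-- Clarke's generalized Jacobian: the convex hull of the limiting Jacobian. -/
def clarkeJacobian (S : E → E) (x : E) : Set (E →L[ℝ] E) :=
  convexHull ℝ (limitingJacobian S x)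

/-- The union of the ranges of the elements of the generalized Jacobian of `S` at `x`. -/
def jacobianRange (S : E → E) (x : E) : Set E :=
  ⋃ W ∈ clarkeJacobian S x, Set.range W

/-- The values `⟪y, z - y⟫` over all `z` and all `W ∈ JS(x)` with `y = W z`. -/
def jacobianPairings (S : E → E) (x y : E) : Set ℝ :=
  {t | ∃ W ∈ clarkeJacobian S x, ∃ z, y = W z ∧ t = inner ℝ y (z - y)}

/-- For `r` proper, lower semicontinuous and convex with `u ∈ ∂r(x)`: a single `Wbar` in the limiting
Jacobian of `Prox_r` at `x + u` has as its range the union of the ranges over the generalized Jacobian,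
and attains, through some `zbar` with `y = Wbar zbar`, the minimum of `⟪y, z - y⟫` for each `y` in it. -/
def JacobianRangeCondition (r : E → EReal) (x u : E) : Prop :=
  LowerSemicontinuous r ∧ IsProperFun r ∧ Convex ℝ (epigraph r) ∧
  x ∈ effDomain r ∧ u ∈ limitingSubdifferential r x ∧
  ∃ Wbar ∈ limitingJacobian (proxMap r) (x + u),
    jacobianRange (proxMap r) (x + u) = Set.range Wbar ∧
    ∀ y ∈ jacobianRange (proxMap r) (x + u), ∃ zbar, y = Wbar zbar ∧
      IsLeast (jacobianPairings (proxMap r) (x + u) y) (inner ℝ y (zbar - y))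

end VariationalAnalysis

/-! ### Symmetric matrices -/

/-- The symmetric matrices inside `ℝ^(ι × ι)` with the Euclidean (i.e. Frobenius) inner product. -/
def symSubmodule (ι : Type*) [Fintype ι] : Submodule ℝ (EuclideanSpace ℝ (ι × ι)) where
  carrier := {x | ∀ i j, x (i, j) = x (j, i)}
  add_mem' := by
    intro a b ha hb i j
    simp [ha i j, hb i j]
  zero_mem' := by
    intro i j
    simp
  smul_mem' := by
    intro c a ha i j
    simp [ha i j]

/-- The Euclidean space of real symmetric matrices, with the Frobenius inner product. -/
abbrev SymMat (ι : Type*) [Fintype ι] : Type _ := ↥(symSubmodule ι)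

/-- The underlying matrix of an element of `SymMat ι`. -/
def SymMat.toMatrix {ι : Type*} [Fintype ι] (X : SymMat ι) : Matrix ι ι ℝ :=
  Matrix.of fun i j => X.1 (i, j)

theorem SymMat.inner_eq_trace {ι : Type*} [Fintype ι] (X Y : SymMat ι) :
    inner ℝ X Y = (X.toMatrixᵀ * Y.toMatrix).trace := by
  rw [Submodule.coe_inner, PiLp.inner_apply, Fintype.sum_prod_type_right]
  simp [Matrix.trace, Matrix.mul_apply, SymMat.toMatrix, mul_comm]

/-- The cone of positive-semidefinite matrices. -/
def psdCone (ι : Type*) [Fintype ι] : Set (SymMat ι) := {X | X.toMatrix.PosSemidef}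

/-- The weights `(max σᵢ 0 + max σⱼ 0) / (|σᵢ| + |σⱼ|)`, with `0 / 0 := 1`. -/
def eigWeight {ι : Type*} (σ : ι → ℝ) (i j : ι) : ℝ :=
  if |σ i| + |σ j| = 0 then 1 else (max (σ i) 0 + max (σ j) 0) / (|σ i| + |σ j|)

/-- With `α = {σ > 0}`, `β = {σ = 0}`, `γ = {σ < 0}`, the matrix with blocks
`[M_αα, M_αβ, Σ_αγ ∘ M_αγ; M_βα, M_ββ, 0; Σ_γα ∘ M_γα, 0, 0]`, where `Σ` is `eigWeight σ`. -/
def blockForm {ι : Type*} (σ : ι → ℝ) (M : Matrix ι ι ℝ) : Matrix ι ι ℝ :=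
  Matrix.of fun i j =>
    if 0 ≤ σ i ∧ 0 ≤ σ j then M i j
    else if (0 < σ i ∧ σ j < 0) ∨ (σ i < 0 ∧ 0 < σ j) then eigWeight σ i j * M i j
    else 0

end

/-!
Order the self-adjoint operators by the Loewner order. The metric projection `Π` onto a closed
convex set is firmly nonexpansive and is a gradient, so the elements `W` of its limiting Jacobian
satisfy `0 ≤ W ≤ 1`. If the limiting Jacobian has a greatest element `V`, then every `W` in its
convex hull satisfies `0 ≤ W ≤ V`. Hence `range W ⊆ range V`, and whenever `W z = V v = y`,
`0 ≤ ⟪W (z - v), z - v⟫ ≤ ⟪y, z⟫ - ⟪y, v⟫`: the minimum is attained at any `V`-preimage of `y`.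

For the positive-semidefinite cone, the Jordan product satisfies `Π X ∘ (Π X - X) = 0`.
Differentiating, and using `|X| = 2 Π X - X`, one finds that `|X| ∘ W D = Π X ∘ D` for each `W` in
the limiting Jacobian. In an eigenbasis of `X` this determines every entry of `W D` outside the
block of zero eigenvalues; letting these eigenvalues tend to zero from above produces an element
which is the identity on that block, and this element is the greatest one because `W ≤ 1`.
-/

noncomputable section

open Filter Asymptotics InnerProductSpace

section IndicatorFunction

variable {α : Type*} {C : Set α}

theorem indicatorFun_of_mem {x : α} (hx : x ∈ C) : indicatorFun C x = 0 := if_pos hx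

theorem indicatorFun_of_notMem {x : α} (hx : x ∉ C) : indicatorFun C x = ⊤ := if_neg hx

theorem effDomain_indicatorFun : effDomain (indicatorFun C) = C := by
  ext x
  by_cases hx : x ∈ C <;> simp [effDomain, hx, indicatorFun_of_mem, indicatorFun_of_notMem]

theorem isProperFun_indicatorFun (hne : C.Nonempty) : IsProperFun (indicatorFun C) := by
  refine ⟨effDomain_indicatorFun.symm ▸ hne, fun x => ?_⟩
  by_cases hx : x ∈ C <;> simp [hx, indicatorFun_of_mem, indicatorFun_of_notMem]

theorem epigraph_indicatorFun : epigraph (indicatorFun C) = C ×ˢ Set.Ici (0 : ℝ) := by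
  ext ⟨x, t⟩
  by_cases hx : x ∈ C <;> simp [epigraph, hx, indicatorFun_of_mem, indicatorFun_of_notMem]

theorem lowerSemicontinuous_indicatorFun [TopologicalSpace α] (hcl : IsClosed C) :
    LowerSemicontinuous (indicatorFun C) := by
  intro x a ha
  by_cases hx : x ∈ C
  · rw [indicatorFun_of_mem hx] at ha
    refine Eventually.of_forall fun y => ha.trans_le ?_
    by_cases hy : y ∈ C <;> simp [hy, indicatorFun_of_mem, indicatorFun_of_notMem]
  · filter_upwards [hcl.isOpen_compl.mem_nhds hx] with y hy
    rwa [indicatorFun_of_notMem hy, ← indicatorFun_of_notMem hx]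

theorem isProxPoint_indicatorFun_iff [NormedAddCommGroup α] (hne : C.Nonempty) {x p : α} :
    IsProxPoint (indicatorFun C) x p ↔ p ∈ C ∧ ∀ q ∈ C, ‖x - p‖ ≤ ‖x - q‖ := by
  have hle (q : α) :
      ((1 / 2 * ‖p - x‖ ^ 2 : ℝ) : EReal) ≤ ((1 / 2 * ‖q - x‖ ^ 2 : ℝ) : EReal) ↔
        ‖x - p‖ ≤ ‖x - q‖ := by
    rw [EReal.coe_le_coe_iff, mul_le_mul_iff_right₀ (by norm_num),
      sq_le_sq₀ (norm_nonneg _) (norm_nonneg _), norm_sub_rev p, norm_sub_rev q]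
  constructor
  · intro h
    have hp : p ∈ C := by
      by_contra hp
      obtain ⟨q, hq⟩ := hne
      have hpq := h q
      rw [indicatorFun_of_mem hq, indicatorFun_of_notMem hp, EReal.top_add_coe, zero_add] at hpq
      exact hpq.not_gt (EReal.coe_lt_top _)
    refine ⟨hp, fun q hq => (hle q).1 ?_⟩
    simpa only [indicatorFun_of_mem hq, indicatorFun_of_mem hp, zero_add] using h q
  · rintro ⟨hp, h⟩ q
    by_cases hq : q ∈ C
    · simpa only [indicatorFun_of_mem hq, indicatorFun_of_mem hp, zero_add] using
        (hle q).2 (h q hq)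
    · rw [indicatorFun_of_notMem hq, EReal.top_add_coe]
      exact le_top

theorem proxMap_indicatorFun [NormedAddCommGroup α] (hne : C.Nonempty) :
    proxMap (indicatorFun C) = metricProj C := by
  funext x
  simp only [proxMap, metricProj, isProxPoint_indicatorFun_iff hne]

end IndicatorFunction

variable {E : Type*} [NormedAddCommGroup E] [InnerProductSpace ℝ E]

section LoewnerOrder

variable {V W : E →L[ℝ] E}

theorem isClosed_Icc_loewner (V W : E →L[ℝ] E) : IsClosed (Set.Icc V W) := by
  have isClosed_isPositive : IsClosed {T : E →L[ℝ] E | T.IsPositive} := by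
    simp only [ContinuousLinearMap.isPositive_iff, LinearMap.IsSymmetric,
      ContinuousLinearMap.coe_coe, Set.ofPred_and, Set.ofPred_forall]
    refine .inter (isClosed_iInter fun x => isClosed_iInter fun y => ?_)
      (isClosed_iInter fun x => ?_)
    · exact isClosed_eq (by fun_prop) (by fun_prop)
    · exact isClosed_le (by fun_prop) (by fun_prop)
  exact (isClosed_isPositive.preimage (continuous_sub_right V)).inter
    (isClosed_isPositive.preimage (continuous_sub_left W))

theorem convex_Icc_loewner (V W : E →L[ℝ] E) : Convex ℝ (Set.Icc V W) := by
  rintro S ⟨hVS, hSW⟩ T ⟨hVT, hTW⟩ a b ha hb hab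
  obtain rfl : b = 1 - a := by linarith
  constructor <;> rw [ContinuousLinearMap.le_def] at *
  · convert (hVS.smul_of_nonneg ha).add (hVT.smul_of_nonneg hb) using 1
    module
  · convert (hSW.smul_of_nonneg ha).add (hTW.smul_of_nonneg hb) using 1
    module

theorem inner_apply_le_of_le (h : V ≤ W) (x : E) : inner ℝ (V x) x ≤ inner ℝ (W x) x := by
  simpa [inner_sub_left] using ((ContinuousLinearMap.le_def V W).1 h).inner_nonneg_left x

theorem apply_eq_zero_of_inner_eq_zero (hW : W.IsPositive) {x : E} (hx : inner ℝ (W x) x = 0) :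
    W x = 0 := by
  refine ext_inner_right ℝ fun y => ?_
  have cauchy_schwarz := LinearMap.BilinForm.apply_sq_le_of_symm
    ((innerₗ E).comp (W : E →ₗ[ℝ] E)) hW.inner_nonneg_left
    ⟨fun x y => (hW.inner_left_eq_inner_right x y).trans (real_inner_comm _ _)⟩ x y
  simpa [hx, sq_nonpos_iff] using cauchy_schwarz

theorem range_subset_range_of_le [FiniteDimensional ℝ E] (hW : 0 ≤ W) (h : W ≤ V) :
    Set.range W ⊆ Set.range V := by
  rw [ContinuousLinearMap.nonneg_iff_isPositive] at hW
  have hV : V.IsPositive := (ContinuousLinearMap.nonneg_iff_isPositive V).1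
    (((ContinuousLinearMap.nonneg_iff_isPositive W).2 hW).trans h)
  have ker_le : V.ker ≤ W.ker := fun x hx => apply_eq_zero_of_inner_eq_zero hW <|
    le_antisymm ((inner_apply_le_of_le h x).trans_eq (by simp [show V x = 0 from hx]))
      (hW.inner_nonneg_left x)
  have range_le : W.range ≤ V.range := by
    rw [← W.range.orthogonal_orthogonal, ← V.range.orthogonal_orthogonal]
    exact Submodule.orthogonal_le <| by
      simpa only [hW.isSymmetric.orthogonal_range, hV.isSymmetric.orthogonal_range] using ker_le
  exact range_le

theorem inner_apply_le_of_apply_eq (hW : W.IsPositive) (h : W ≤ V) {x z : E} (hxz : W x = V z) :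
    inner ℝ (V z) z ≤ inner ℝ (W x) x := by
  have hdiff := hW.inner_nonneg_left (x - z)
  have hle := inner_apply_le_of_le h z
  have hcross : inner ℝ (W z) x = inner ℝ (V z) z := by
    rw [hW.inner_left_eq_inner_right, hxz, real_inner_comm]
  simp only [map_sub, inner_sub_left, inner_sub_right, hcross, hxz] at hdiff ⊢
  linarith

theorem isPositive_of_range_le (K : Submodule ℝ E) [K.HasOrthogonalProjection]
    (hsymm : (W : E →ₗ[ℝ] E).IsSymmetric) (hrange : ∀ x, W x ∈ K)
    (hK : ∀ k ∈ K, 0 ≤ inner ℝ (W k) k) : W.IsPositive := by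
  refine (ContinuousLinearMap.isPositive_iff W).2 ⟨hsymm, fun x => ?_⟩
  have hproj (y : E) : inner ℝ (W y) x = inner ℝ (W y) (K.starProjection x) := by
    rw [← sub_eq_zero, ← inner_sub_right]
    exact (K.sub_starProjection_mem_orthogonal x) _ (hrange y)
  calc 0 ≤ inner ℝ (W (K.starProjection x)) (K.starProjection x) :=
        hK _ (K.starProjection_apply_mem x)
    _ = inner ℝ (W (K.starProjection x)) x := (hproj _).symm
    _ = inner ℝ (W x) (K.starProjection x) := by
        rw [real_inner_comm]; exact (hsymm x _).symm
    _ = inner ℝ (W x) x := (hproj x).symm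

end LoewnerOrder

section LimitingJacobian

variable {S : E → E} {x : E}

theorem mem_limitingJacobian_of_tendsto {ι : Type*} {l : Filter ι} [l.NeBot]
    [l.IsCountablyGenerated] {y : ι → E} {S' : ι → E →L[ℝ] E} {V : E →L[ℝ] E}
    (hS : ∀ᶠ a in l, HasFDerivAt S (S' a) (y a)) (hy : Tendsto y l (𝓝 x))
    (hS' : Tendsto S' l (𝓝 V)) : V ∈ limitingJacobian S x := by
  obtain ⟨a, ha⟩ := l.exists_seq_tendsto
  obtain ⟨N, hN⟩ := eventually_atTop.1 (ha.eventually hS)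
  have hshift : Tendsto (fun k => a (k + N)) atTop l := ha.comp (tendsto_add_atTop_nat N)
  have hderiv (k : ℕ) : HasFDerivAt S (S' (a (k + N))) (y (a (k + N))) := hN _ (by omega)
  exact ⟨fun k => y (a (k + N)), fun k => (hderiv k).differentiableAt, hy.comp hshift,
    (hS'.comp hshift).congr fun k => (hderiv k).fderiv.symm⟩

theorem limitingJacobian_subset_of_isClosed {K : Set (E →L[ℝ] E)} (hK : IsClosed K)
    (h : ∀ y, DifferentiableAt ℝ S y → fderiv ℝ S y ∈ K) : limitingJacobian S x ⊆ K := by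
  rintro V ⟨xs, hdiff, -, hV⟩
  exact hK.mem_of_tendsto hV (Eventually.of_forall fun k => h _ (hdiff k))

variable {V : E →L[ℝ] E}

theorem clarkeJacobian_subset_Icc (h0 : limitingJacobian S x ⊆ Set.Ici 0)
    (hV : V ∈ upperBounds (limitingJacobian S x)) : clarkeJacobian S x ⊆ Set.Icc 0 V :=
  convexHull_min (fun _ hW => ⟨h0 hW, hV hW⟩) (convex_Icc_loewner 0 V)

theorem jacobianRange_eq_range_of_isGreatest [FiniteDimensional ℝ E]
    (h0 : limitingJacobian S x ⊆ Set.Ici 0) (hV : IsGreatest (limitingJacobian S x) V) :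
    jacobianRange S x = Set.range V := by
  refine (Set.iUnion₂_subset fun W hW => ?_).antisymm
    (Set.subset_biUnion_of_mem (u := fun W : E →L[ℝ] E => Set.range W)
      (subset_convexHull ℝ _ hV.1))
  obtain ⟨hW0, hWV⟩ := clarkeJacobian_subset_Icc h0 hV.2 hW
  exact range_subset_range_of_le hW0 hWV

theorem isLeast_jacobianPairings_of_isGreatest (h0 : limitingJacobian S x ⊆ Set.Ici 0)
    (hV : IsGreatest (limitingJacobian S x) V) (z : E) :
    IsLeast (jacobianPairings S x (V z)) (inner ℝ (V z) (z - V z)) := by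
  refine ⟨⟨V, subset_convexHull ℝ _ hV.1, z, rfl, rfl⟩, ?_⟩
  rintro _ ⟨W, hW, z', hz', rfl⟩
  obtain ⟨hW0, hWV⟩ := clarkeJacobian_subset_Icc h0 hV.2 hW
  have := inner_apply_le_of_apply_eq ((ContinuousLinearMap.nonneg_iff_isPositive W).1 hW0) hWV
    hz'.symm
  rw [inner_sub_right, inner_sub_right, hz']
  simpa [← hz'] using this

end LimitingJacobian

section Gradients

theorem inner_nonneg_of_hasFDerivAt_of_monotone {f : E → E} {f' : E →L[ℝ] E} {x : E}
    (hf : ∀ x y, 0 ≤ inner ℝ (f x - f y) (x - y)) (hf' : HasFDerivAt f f' x) (d : E) :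
    0 ≤ inner ℝ (f' d) d := by
  have hline : HasDerivAt (fun t : ℝ => f (x + t • d)) (f' d) 0 := hf'.hasLineDerivAt d
  have hslope := hasDerivAt_iff_tendsto_slope.1 hline
  refine ge_of_tendsto (hslope.inner tendsto_const_nhds) (Eventually.of_forall fun t => ?_)
  have h := mul_nonneg (sq_nonneg t⁻¹) (hf (x + t • d) x)
  simp only [add_sub_cancel_left, inner_smul_right] at h
  obtain rfl | ht := eq_or_ne t 0
  · simp
  · simp only [slope, sub_zero, zero_smul, add_zero, vsub_eq_sub, real_inner_smul_left]
    convert h using 1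
    field_simp

variable [CompleteSpace E] {φ : E → ℝ} {f : E → E} {x : E}

theorem hasGradientAt_of_forall_inner_le (hf : ContinuousAt f x)
    (hφ : ∀ y z, φ y + inner ℝ (f y) (z - y) ≤ φ z) : HasGradientAt φ (f x) x := by
  rw [hasGradientAt_iff_isLittleO]
  have hbound (z : E) : ‖φ z - φ x - inner ℝ (f x) (z - x)‖ ≤ ‖f z - f x‖ * ‖z - x‖ := by
    have hxz := hφ x z
    have hzx := hφ z x
    rw [← neg_sub z x, inner_neg_right] at hzx
    rw [Real.norm_of_nonneg (by linarith)]
    calc φ z - φ x - inner ℝ (f x) (z - x) ≤ inner ℝ (f z - f x) (z - x) := by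
          rw [inner_sub_left]; linarith
      _ ≤ ‖f z - f x‖ * ‖z - x‖ := real_inner_le_norm _ _
  have hsmall : (fun z => ‖f z - f x‖) =o[𝓝 x] fun _ => (1 : ℝ) :=
    (isLittleO_one_iff ℝ).2 (tendsto_iff_norm_sub_tendsto_zero.1 hf)
  have hprod : (fun z => ‖f z - f x‖ * ‖z - x‖) =o[𝓝 x] fun z => z - x := by
    simpa using (hsmall.mul_isBigO (isBigO_refl (fun z => ‖z - x‖) (𝓝 x))).norm_right
  exact (IsBigO.of_norm_le hbound).trans_isLittleO hprod

theorem isSymmetric_fderiv_of_hasGradientAt (hφ : ∀ y, HasGradientAt φ (f y) y)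
    (hd : DifferentiableAt ℝ f x) : (fderiv ℝ f x : E →ₗ[ℝ] E).IsSymmetric := fun d e => by
  have h := second_derivative_symmetric (fun y => (hφ y).hasFDerivAt)
    ((toDual ℝ E).toContinuousLinearEquiv.hasFDerivAt.comp x hd.hasFDerivAt) d e
  exact h.trans (real_inner_comm _ _)

end Gradients

section MetricProjection

variable [CompleteSpace E] {C : Set E}

theorem metricProj_mem_and_norm_sub_le (hne : C.Nonempty) (hcl : IsClosed C) (hconv : Convex ℝ C)
    (x : E) : metricProj C x ∈ C ∧ ∀ q ∈ C, ‖x - metricProj C x‖ ≤ ‖x - q‖ := by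
  obtain ⟨p, hp, hmin⟩ := exists_norm_eq_iInf_of_complete_convex hne hcl.isComplete hconv x
  refine Classical.epsilon_spec (p := fun p => p ∈ C ∧ ∀ q ∈ C, ‖x - p‖ ≤ ‖x - q‖)
    ⟨p, hp, fun q hq => hmin.trans_le ?_⟩
  exact ciInf_le ⟨0, Set.forall_mem_range.2 fun _ => norm_nonneg _⟩ (⟨q, hq⟩ : C)

theorem inner_sub_metricProj_le_zero (hne : C.Nonempty) (hcl : IsClosed C) (hconv : Convex ℝ C)
    (x : E) {q : E} (hq : q ∈ C) : inner ℝ (x - metricProj C x) (q - metricProj C x) ≤ 0 := by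
  obtain ⟨hmem, hmin⟩ := metricProj_mem_and_norm_sub_le hne hcl hconv x
  have := hne.to_subtype
  refine (norm_eq_iInf_iff_real_inner_le_zero hconv hmem).1 (le_antisymm ?_ ?_) q hq
  · exact le_ciInf fun q : C => hmin q q.2
  · exact ciInf_le ⟨0, Set.forall_mem_range.2 fun _ => norm_nonneg _⟩ (⟨_, hmem⟩ : C)

theorem metricProj_eq_of_inner_le_zero (hcl : IsClosed C) (hconv : Convex ℝ C) {x p : E}
    (hp : p ∈ C) (h : ∀ q ∈ C, inner ℝ (x - p) (q - p) ≤ 0) : metricProj C x = p := by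
  have hproj := inner_sub_metricProj_le_zero ⟨p, hp⟩ hcl hconv x hp
  have hp' := h _ (metricProj_mem_and_norm_sub_le ⟨p, hp⟩ hcl hconv x).1
  rw [← sub_eq_zero, ← real_inner_self_nonpos]
  simp only [inner_sub_left, inner_sub_right] at hproj hp' ⊢
  linarith [real_inner_comm p (metricProj C x)]

theorem metricProj_linearIsometryEquiv_apply {F : Type*} [NormedAddCommGroup F]
    [InnerProductSpace ℝ F] (hne : C.Nonempty) (hcl : IsClosed C) (hconv : Convex ℝ C)
    (e : F ≃ₗᵢ[ℝ] E) (x : F) : metricProj C (e x) = e (metricProj (e ⁻¹' C) x) := by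
  have : CompleteSpace F := (completeSpace_congr (e := e.toEquiv)
    e.isometry.isUniformEmbedding).2 ‹_›
  have hne' : (e ⁻¹' C).Nonempty := hne.preimage e.surjective
  have hcl' : IsClosed (e ⁻¹' C) := hcl.preimage e.continuous
  have hconv' : Convex ℝ (e ⁻¹' C) := hconv.linear_preimage e.toLinearMap
  refine metricProj_eq_of_inner_le_zero hcl hconv
    (metricProj_mem_and_norm_sub_le hne' hcl' hconv' x).1 fun q hq => ?_
  obtain ⟨q, rfl⟩ := e.surjective q
  rw [← map_sub, ← map_sub, LinearIsometryEquiv.inner_map_map]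
  exact inner_sub_metricProj_le_zero hne' hcl' hconv' x hq

theorem norm_sq_metricProj_sub_le_inner (hne : C.Nonempty) (hcl : IsClosed C)
    (hconv : Convex ℝ C) (x y : E) :
    ‖metricProj C x - metricProj C y‖ ^ 2 ≤ inner ℝ (metricProj C x - metricProj C y) (x - y) := by
  have hxy := inner_sub_metricProj_le_zero hne hcl hconv x
    (metricProj_mem_and_norm_sub_le hne hcl hconv y).1
  have hyx := inner_sub_metricProj_le_zero hne hcl hconv y
    (metricProj_mem_and_norm_sub_le hne hcl hconv x).1
  rw [← real_inner_self_eq_norm_sq]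
  simp only [inner_sub_left, inner_sub_right] at hxy hyx ⊢
  linarith [real_inner_comm x (metricProj C x), real_inner_comm y (metricProj C x),
    real_inner_comm x (metricProj C y), real_inner_comm y (metricProj C y)]

theorem lipschitzWith_metricProj (hne : C.Nonempty) (hcl : IsClosed C) (hconv : Convex ℝ C) :
    LipschitzWith 1 (metricProj C) := by
  refine LipschitzWith.of_dist_le_mul fun x y => ?_
  have hfirm := norm_sq_metricProj_sub_le_inner hne hcl hconv x y
  have hcs := real_inner_le_norm (metricProj C x - metricProj C y) (x - y)
  rw [dist_eq_norm, dist_eq_norm, NNReal.coe_one, one_mul]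
  by_contra! hlt
  nlinarith [norm_nonneg (x - y)]

theorem inner_sub_half_sq_le_metricProj (hne : C.Nonempty) (hcl : IsClosed C)
    (hconv : Convex ℝ C) (x : E) {q : E} (hq : q ∈ C) :
    inner ℝ q x - ‖q‖ ^ 2 / 2 ≤ inner ℝ (metricProj C x) x - ‖metricProj C x‖ ^ 2 / 2 := by
  have hmin := (metricProj_mem_and_norm_sub_le hne hcl hconv x).2 q hq
  have hsq := pow_le_pow_left₀ (norm_nonneg _) hmin 2
  rw [norm_sub_sq_real, norm_sub_sq_real, real_inner_comm, real_inner_comm q] at hsq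
  linarith

-- Being a gradient is what makes the derivatives of the projection symmetric.
theorem hasGradientAt_metricProj (hne : C.Nonempty) (hcl : IsClosed C) (hconv : Convex ℝ C)
    (x : E) :
    HasGradientAt (fun y => inner ℝ (metricProj C y) y - ‖metricProj C y‖ ^ 2 / 2)
      (metricProj C x) x := by
  refine hasGradientAt_of_forall_inner_le
    (lipschitzWith_metricProj hne hcl hconv).continuous.continuousAt fun y z => ?_
  have := inner_sub_half_sq_le_metricProj hne hcl hconv z
    (metricProj_mem_and_norm_sub_le hne hcl hconv y).1
  rw [inner_sub_right]
  linarith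

theorem limitingJacobian_metricProj_subset_Icc (hne : C.Nonempty) (hcl : IsClosed C)
    (hconv : Convex ℝ C) (x : E) : limitingJacobian (metricProj C) x ⊆ Set.Icc 0 1 := by
  refine limitingJacobian_subset_of_isClosed (isClosed_Icc_loewner 0 1) fun y hd => ?_
  have hsymm := isSymmetric_fderiv_of_hasGradientAt (hasGradientAt_metricProj hne hcl hconv) hd
  have hfirm := norm_sq_metricProj_sub_le_inner hne hcl hconv
  constructor
  · rw [ContinuousLinearMap.nonneg_iff_isPositive, ContinuousLinearMap.isPositive_iff]
    exact ⟨hsymm, inner_nonneg_of_hasFDerivAt_of_monotone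
      (fun x y => (sq_nonneg _).trans (hfirm x y)) hd.hasFDerivAt⟩
  · rw [ContinuousLinearMap.le_def, ContinuousLinearMap.isPositive_iff]
    refine ⟨LinearMap.IsSymmetric.id.sub hsymm, fun d => ?_⟩
    have hmono (x y : E) :
        0 ≤ inner ℝ ((x - metricProj C x) - (y - metricProj C y)) (x - y) := by
      have hlip := (lipschitzWith_metricProj hne hcl hconv).dist_le_mul x y
      rw [dist_eq_norm, dist_eq_norm, NNReal.coe_one, one_mul] at hlip
      have hcs := real_inner_le_norm (metricProj C x - metricProj C y) (x - y)
      rw [sub_sub_sub_comm, inner_sub_left, real_inner_self_eq_norm_sq]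
      nlinarith [norm_nonneg (x - y)]
    exact inner_nonneg_of_hasFDerivAt_of_monotone hmono ((hasFDerivAt_id y).sub hd.hasFDerivAt) d

end MetricProjection

section NormalCone

variable {C : Set E}

theorem limitingNormalCone_subset_limitingSubdifferential (x : E) :
    limitingNormalCone C x ⊆ limitingSubdifferential (indicatorFun C) x := by
  rintro y ⟨hx, xs, ys, hxs, hmem, hys⟩
  refine ⟨effDomain_indicatorFun.symm ▸ hx, xs, ys, hxs, ?_, fun k => ?_, hys⟩
  · simp only [indicatorFun_of_mem hx, indicatorFun_of_mem (hmem _).1]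
    exact tendsto_const_nhds
  · obtain ⟨hk, -, hN⟩ := hmem k
    refine ⟨effDomain_indicatorFun.symm ▸ hk, fun ε hε => ?_⟩
    filter_upwards [eventually_nhdsWithin_iff.1 (hN ε hε)] with z hz
    by_cases hzC : z ∈ C
    · rw [indicatorFun_of_mem hk, indicatorFun_of_mem hzC, zero_add]
      exact_mod_cast sub_nonpos.2 (hz hzC)
    · simp [indicatorFun_of_notMem hzC]

theorem jacobianRangeCondition_indicatorFun_of_isGreatest [FiniteDimensional ℝ E]
    (hcl : IsClosed C) (hconv : Convex ℝ C) {x u : E} (hu : u ∈ limitingNormalCone C x)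
    {V : E →L[ℝ] E} (hV : IsGreatest (limitingJacobian (metricProj C) (x + u)) V) :
    JacobianRangeCondition (indicatorFun C) x u := by
  have hx : x ∈ C := hu.1
  have hne : C.Nonempty := ⟨x, hx⟩
  have h0 : limitingJacobian (metricProj C) (x + u) ⊆ Set.Ici 0 :=
    (limitingJacobian_metricProj_subset_Icc hne hcl hconv _).trans Set.Icc_subset_Ici_self
  have hrange := jacobianRange_eq_range_of_isGreatest h0 hV
  refine ⟨lowerSemicontinuous_indicatorFun hcl, isProperFun_indicatorFun hne,
    epigraph_indicatorFun ▸ hconv.prod (convex_Ici 0), effDomain_indicatorFun.symm ▸ hx,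
    limitingNormalCone_subset_limitingSubdifferential x hu, ?_⟩
  rw [proxMap_indicatorFun hne]
  refine ⟨V, hV.1, hrange, fun y hy => ?_⟩
  obtain ⟨z, rfl⟩ := hrange ▸ hy
  exact ⟨z, rfl, isLeast_jacobianPairings_of_isGreatest h0 hV z⟩

end NormalCone

section Complementarity

variable {B : E →L[ℝ] E →L[ℝ] E} {f : E → E} {x : E}

theorem comp_fderiv_eq_of_complementary (hB : ∀ y z, B y z = B z y)
    (hf : ∀ y, B (f y) (f y - y) = 0) (hd : DifferentiableAt ℝ f x) :
    (B (2 • f x - x)).comp (fderiv ℝ f x) = B (f x) := by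
  ext d
  have hderiv := B.hasFDerivAt_of_bilinear hd.hasFDerivAt
    (hd.hasFDerivAt.fun_sub (hasFDerivAt_id x))
  have hconst : HasFDerivAt (fun y => B (f y) (f y - id y)) (0 : E →L[ℝ] E) x := by
    simpa only [id, hf] using hasFDerivAt_const (0 : E) x
  have hzero : B (f x) (fderiv ℝ f x d - d) + B (fderiv ℝ f x d) (f x - x) = 0 :=
    DFunLike.congr_fun (hderiv.unique hconst) d
  simp only [map_sub] at hzero
  simp only [ContinuousLinearMap.comp_apply, map_sub, map_nsmul, sub_apply, smul_apply]
  linear_combination (norm := module)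
    hzero + hB (f x) (fderiv ℝ f x d) + hB (fderiv ℝ f x d) x

theorem comp_eq_of_mem_limitingJacobian (hB : ∀ y z, B y z = B z y)
    (hf : ∀ y, B (f y) (f y - y) = 0) (hcont : ContinuousAt f x) {V : E →L[ℝ] E}
    (hV : V ∈ limitingJacobian f x) : (B (2 • f x - x)).comp V = B (f x) := by
  obtain ⟨xs, hdiff, hxs, hlim⟩ := hV
  have hfxs : Tendsto (fun k => f (xs k)) atTop (𝓝 (f x)) := hcont.tendsto.comp hxs
  have hleft : Tendsto (fun k => (B (2 • f (xs k) - xs k)).comp (fderiv ℝ f (xs k))) atTop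
      (𝓝 ((B (2 • f x - x)).comp V)) :=
    (isBoundedBilinearMap_comp.continuous.tendsto (_, _)).comp
      (((B.continuous.tendsto _).comp ((hfxs.const_smul 2).sub hxs)).prodMk_nhds hlim)
  simp only [comp_fderiv_eq_of_complementary hB hf (hdiff _)] at hleft
  exact tendsto_nhds_unique hleft ((B.continuous.tendsto _).comp hfxs)

theorem hasFDerivAt_of_complementary {K : NNReal} (hB : ∀ y z, B y z = B z y)
    (hf : ∀ y, B (f y) (f y - y) = 0) (hlip : LipschitzWith K f) {T : E →L[ℝ] E}
    (hT : T.comp (B (2 • f x - x)) = .id ℝ E) : HasFDerivAt f (T.comp (B (f x))) x := by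
  have hincr : (fun z => f z - f x) =O[𝓝 x] fun z => z - x :=
    IsBigO.of_bound K (Eventually.of_forall fun z => hlip.norm_sub_le z x)
  have hremainder (z : E) : f z - f x - T (B (f x) (z - x)) =
      -T (B (f z - f x) (f z - f x - (z - x))) := by
    have hinv : T (B (2 • f x - x) (f z - f x)) = f z - f x := DFunLike.congr_fun hT _
    have hexpand : B (2 • f x - x) (f z - f x) =
        B (f x) (z - x) - B (f z - f x) (f z - f x - (z - x)) := by
      have hx := hf x
      have hz := hf z
      simp only [map_sub, map_nsmul, sub_apply, smul_apply] at hx hz ⊢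
      linear_combination (norm := module)
        hz - hx + hB (f x) (f z) + hB (f z) x + hB x (f x)
    rw [hexpand, map_sub] at hinv
    linear_combination (norm := module) (-1 : ℝ) • hinv
  have hquad : (fun z => f z - f x - T (B (f x) (z - x))) =O[𝓝 x] fun z => ‖z - x‖ ^ 2 := by
    have hB' : (fun z => B (f z - f x) (f z - f x - (z - x))) =O[𝓝 x]
        fun z => ‖f z - f x‖ * ‖f z - f x - (z - x)‖ := IsBigO.of_bound ‖B‖ <|
      Eventually.of_forall fun z => by
        simpa [mul_assoc] using B.le_opNorm₂ (f z - f x) (f z - f x - (z - x))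
    simp only [hremainder, sq]
    exact ((T.isBigO_comp _ _).trans (hB'.trans
      (hincr.norm_norm.mul (hincr.sub (isBigO_refl _ _)).norm_norm))).neg_left
  refine HasFDerivAt.of_isLittleO (hquad.trans_isLittleO ?_)
  exact (isLittleO_norm_pow_id one_lt_two).comp_tendsto
    (tendsto_sub_nhds_zero_iff.2 tendsto_id)

theorem isGreatest_limitingJacobian_of_complementary [FiniteDimensional ℝ E]
    (hB : ∀ y z, B y z = B z y) (hf : ∀ y, B (f y) (f y - y) = 0) (hcont : ContinuousAt f x)
    (hIcc : limitingJacobian f x ⊆ Set.Icc 0 1) {V : E →L[ℝ] E} (hV : V ∈ limitingJacobian f x)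
    (hker : ∀ k, B (2 • f x - x) k = 0 → V k = k) : IsGreatest (limitingJacobian f x) V := by
  refine ⟨hV, fun W hW => ?_⟩
  have hV0 := (ContinuousLinearMap.nonneg_iff_isPositive V).1 (hIcc hV).1
  have hW0 := (ContinuousLinearMap.nonneg_iff_isPositive W).1 (hIcc hW).1
  -- `V - W` maps into the kernel of `B (2 • f x - x)`, and on that kernel it is `1 - W ≥ 0`.
  refine isPositive_of_range_le (B (2 • f x - x)).ker
    (hV0.isSymmetric.sub hW0.isSymmetric) (fun d => ?_) fun k hk => ?_
  · have hVW := (comp_eq_of_mem_limitingJacobian hB hf hcont hV).trans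
      (comp_eq_of_mem_limitingJacobian hB hf hcont hW).symm
    exact (map_sub _ _ _).trans (sub_eq_zero.2 (DFunLike.congr_fun hVW d))
  · have := inner_apply_le_of_le (hIcc hW).2 k
    simpa [hker k hk, inner_sub_left] using this

end Complementarity

namespace SymMat

open Matrix

variable {ι : Type*} [Fintype ι]

theorem isSymm_toMatrix (X : SymMat ι) : X.toMatrix.IsSymm := Matrix.ext fun i j => X.2 j i

theorem isHermitian_toMatrix (X : SymMat ι) : X.toMatrix.IsHermitian :=
  (conjTranspose_eq_transpose_of_trivial _).trans X.isSymm_toMatrix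

theorem toMatrix_injective : Function.Injective (toMatrix : SymMat ι → Matrix ι ι ℝ) :=
  fun _ _ h => Subtype.ext (PiLp.ext fun p => congr_fun₂ h p.1 p.2)

@[simp] theorem toMatrix_zero : (0 : SymMat ι).toMatrix = 0 := rfl

@[simp] theorem toMatrix_add (X Y : SymMat ι) :
    (X + Y).toMatrix = X.toMatrix + Y.toMatrix := rfl

@[simp] theorem toMatrix_sub (X Y : SymMat ι) :
    (X - Y).toMatrix = X.toMatrix - Y.toMatrix := rfl

@[simp] theorem toMatrix_smul (c : ℝ) (X : SymMat ι) : (c • X).toMatrix = c • X.toMatrix := rfl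

theorem continuous_toMatrix : Continuous (toMatrix : SymMat ι → Matrix ι ι ℝ) :=
  continuous_matrix fun i j =>
    (EuclideanSpace.proj (𝕜 := ℝ) (i, j)).continuous.comp continuous_subtype_val

theorem tendsto_iff_forall_toMatrix {β : Type*} {l : Filter β} {f : β → SymMat ι} {X : SymMat ι} :
    Tendsto f l (𝓝 X) ↔
      ∀ i j, Tendsto (fun b => (f b).toMatrix i j) l (𝓝 (X.toMatrix i j)) := by
  refine ⟨fun h i j => ((continuous_toMatrix.matrix_elem i j).tendsto X).comp h, fun h => ?_⟩
  refine tendsto_subtype_rng.2 (((PiLp.continuous_toLp 2 _).tendsto _).comp (tendsto_pi_nhds.2 ?_))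
  exact fun p => h p.1 p.2

theorem inner_eq_sum (X Y : SymMat ι) :
    inner ℝ X Y = ∑ i, ∑ j, X.toMatrix i j * Y.toMatrix i j := by
  rw [inner_eq_trace, X.isSymm_toMatrix]
  simp only [trace, diag_apply, mul_apply, Y.isSymm_toMatrix.apply]

/-- The element of `SymMat ι` with a given symmetric underlying matrix. -/
def ofMatrix (A : Matrix ι ι ℝ) (hA : A.IsSymm) : SymMat ι :=
  ⟨WithLp.toLp 2 fun p => A p.1 p.2, fun i j => hA.apply j i⟩

@[simp] theorem toMatrix_ofMatrix (A : Matrix ι ι ℝ) (hA : A.IsSymm) :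
    (ofMatrix A hA).toMatrix = A := rfl

theorem isSymm_transpose_mul_mul (Q : Matrix ι ι ℝ) (D : SymMat ι) :
    (Qᵀ * D.toMatrix * Q).IsSymm := by
  simp [IsSymm, transpose_mul, D.isSymm_toMatrix.eq, Matrix.mul_assoc]

/-- The congruence `D ↦ Qᵀ D Q` as a linear map, for an arbitrary square matrix `Q`. -/
def congruence (Q : Matrix ι ι ℝ) : SymMat ι →ₗ[ℝ] SymMat ι where
  toFun D := ofMatrix (Qᵀ * D.toMatrix * Q) (isSymm_transpose_mul_mul Q D)
  map_add' D D' := toMatrix_injective (by simp [Matrix.mul_add, Matrix.add_mul])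
  map_smul' c D := toMatrix_injective (by simp)

@[simp] theorem toMatrix_congruence (Q : Matrix ι ι ℝ) (D : SymMat ι) :
    (congruence Q D).toMatrix = Qᵀ * D.toMatrix * Q := rfl

theorem inner_congruence_right (Q : Matrix ι ι ℝ) (X Y : SymMat ι) :
    inner ℝ X (congruence Q Y) = inner ℝ (congruence Qᵀ X) Y := by
  rw [inner_eq_trace, inner_eq_trace, X.isSymm_toMatrix.eq, (isSymm_toMatrix _).eq,
    toMatrix_congruence, toMatrix_congruence, transpose_transpose, ← Matrix.mul_assoc,
    trace_mul_comm]
  simp only [Matrix.mul_assoc]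

theorem isSymm_mul_add_mul (X Y : SymMat ι) :
    (X.toMatrix * Y.toMatrix + Y.toMatrix * X.toMatrix).IsSymm := by
  simp [IsSymm, transpose_mul, X.isSymm_toMatrix.eq, Y.isSymm_toMatrix.eq, add_comm]

/-- The anticommutator `X Y + Y X`, twice the Jordan product, as a bilinear map: it expresses the
complementarity of the positive and negative parts of a symmetric matrix. -/
def anticommutator : SymMat ι →L[ℝ] SymMat ι →L[ℝ] SymMat ι :=
  (LinearMap.mk₂ ℝ (fun X Y => ofMatrix _ (isSymm_mul_add_mul X Y))
    (fun X X' Y => toMatrix_injective (by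
      simp only [toMatrix_ofMatrix, toMatrix_add, Matrix.mul_add, Matrix.add_mul]
      abel))
    (fun c X Y => toMatrix_injective (by simp))
    (fun X Y Y' => toMatrix_injective (by
      simp only [toMatrix_ofMatrix, toMatrix_add, Matrix.mul_add, Matrix.add_mul]
      abel))
    (fun c X Y => toMatrix_injective (by simp))).toContinuousBilinearMap

theorem toMatrix_anticommutator (X Y : SymMat ι) :
    (anticommutator X Y).toMatrix = X.toMatrix * Y.toMatrix + Y.toMatrix * X.toMatrix := rfl

theorem anticommutator_comm (X Y : SymMat ι) : anticommutator X Y = anticommutator Y X :=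
  toMatrix_injective (by simp only [toMatrix_anticommutator, add_comm])

theorem isSymm_hadamard (X Y : SymMat ι) : (X.toMatrix ⊙ Y.toMatrix).IsSymm := by
  simp [IsSymm, X.isSymm_toMatrix.eq, Y.isSymm_toMatrix.eq, transpose_hadamard]

/-- The entrywise inverse of a symmetric matrix, with `0⁻¹ = 0`; multiplication by these weights is
the pseudoinverse of multiplication by `w`. -/
def entrywiseInv (w : SymMat ι) : SymMat ι :=
  ofMatrix (w.toMatrix.map (·⁻¹)) (w.isSymm_toMatrix.map _)

@[simp] theorem toMatrix_entrywiseInv (w : SymMat ι) (i j : ι) :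
    (entrywiseInv w).toMatrix i j = (w.toMatrix i j)⁻¹ := rfl

/-- The matrix with entries `aᵢ + aⱼ`, the weights by which the anticommutator with the diagonal
matrix of `a` multiplies. -/
def pairSums (a : ι → ℝ) : SymMat ι :=
  ofMatrix (of fun i j => a i + a j) (Matrix.ext fun _ _ => add_comm _ _)

@[simp] theorem toMatrix_pairSums (a : ι → ℝ) (i j : ι) :
    (pairSums a).toMatrix i j = a i + a j := rfl

variable [DecidableEq ι]

/-- The diagonal matrix with diagonal `d`, as an element of `SymMat ι`. -/
def diagonal (d : ι → ℝ) : SymMat ι := ofMatrix (Matrix.diagonal d) (isSymm_diagonal d)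

@[simp] theorem toMatrix_diagonal (d : ι → ℝ) : (diagonal d).toMatrix = Matrix.diagonal d := rfl

theorem congruence_congruence_of_mul_eq_one {Q R : Matrix ι ι ℝ} (h : Q * R = 1)
    (D : SymMat ι) : congruence R (congruence Q D) = D := toMatrix_injective <| by
  rw [toMatrix_congruence, toMatrix_congruence,
    show Rᵀ * (Qᵀ * D.toMatrix * Q) * R = (Q * R)ᵀ * D.toMatrix * (Q * R) by
      rw [transpose_mul]; noncomm_ring, h, transpose_one, Matrix.one_mul, Matrix.mul_one]

/-- The coordinates `Pᵀ X P` of `X` in the orthonormal basis formed by the columns of `P`. -/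
def coords (P : orthogonalGroup ι ℝ) : SymMat ι ≃ₗᵢ[ℝ] SymMat ι where
  toFun := congruence P
  invFun := congruence (P : Matrix ι ι ℝ)ᵀ
  map_add' := map_add _
  map_smul' := map_smul _
  left_inv := congruence_congruence_of_mul_eq_one ((mem_orthogonalGroup_iff ι ℝ).1 P.2)
  right_inv := congruence_congruence_of_mul_eq_one ((mem_orthogonalGroup_iff' ι ℝ).1 P.2)
  norm_map' D := by
    refine (sq_eq_sq₀ (norm_nonneg _) (norm_nonneg _)).1 ?_
    rw [← real_inner_self_eq_norm_sq, ← real_inner_self_eq_norm_sq]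
    change inner ℝ (congruence P D) (congruence P D) = _
    rw [inner_congruence_right,
      congruence_congruence_of_mul_eq_one ((mem_orthogonalGroup_iff ι ℝ).1 P.2)]

variable (P : orthogonalGroup ι ℝ)

theorem toMatrix_coords (X : SymMat ι) :
    (coords P X).toMatrix = (P : Matrix ι ι ℝ)ᵀ * X.toMatrix * P := rfl

theorem toMatrix_coords_symm (X : SymMat ι) :
    ((coords P).symm X).toMatrix = P * X.toMatrix * (P : Matrix ι ι ℝ)ᵀ := by
  change ((P : Matrix ι ι ℝ)ᵀ)ᵀ * X.toMatrix * (P : Matrix ι ι ℝ)ᵀ = _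
  rw [transpose_transpose]

variable {P}

theorem coords_eq_iff {X Y : SymMat ι} :
    coords P X = Y ↔ X.toMatrix = P * Y.toMatrix * (P : Matrix ι ι ℝ)ᵀ := by
  rw [← toMatrix_coords_symm, toMatrix_injective.eq_iff, LinearIsometryEquiv.eq_symm_apply]

theorem ext_coords (P : orthogonalGroup ι ℝ) {X Y : SymMat ι}
    (h : ∀ i j, (coords P X).toMatrix i j = (coords P Y).toMatrix i j) : X = Y :=
  (coords P).injective (toMatrix_injective (Matrix.ext h))

theorem coords_anticommutator (P : orthogonalGroup ι ℝ) (X Y : SymMat ι) :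
    coords P (anticommutator X Y) = anticommutator (coords P X) (coords P Y) := by
  have hmul (A B : Matrix ι ι ℝ) : (P : Matrix ι ι ℝ)ᵀ * A * P * ((P : Matrix ι ι ℝ)ᵀ * B * P) =
      (P : Matrix ι ι ℝ)ᵀ * (A * B) * P := by
    have hP : (P : Matrix ι ι ℝ) * (P : Matrix ι ι ℝ)ᵀ = 1 := (mem_orthogonalGroup_iff ι ℝ).1 P.2
    rw [show (P : Matrix ι ι ℝ)ᵀ * A * P * ((P : Matrix ι ι ℝ)ᵀ * B * P) =
      (P : Matrix ι ι ℝ)ᵀ * (A * (P * (P : Matrix ι ι ℝ)ᵀ) * B) * P by noncomm_ring, hP,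
      Matrix.mul_one]
  apply toMatrix_injective
  simp only [toMatrix_anticommutator, toMatrix_coords, hmul, Matrix.mul_add, Matrix.add_mul]

theorem toMatrix_coords_anticommutator {A : SymMat ι} {a : ι → ℝ} (hA : coords P A = diagonal a)
    (D : SymMat ι) (i j : ι) : (coords P (anticommutator A D)).toMatrix i j =
      (a i + a j) * (coords P D).toMatrix i j := by
  rw [coords_anticommutator, hA]
  simp [toMatrix_anticommutator, diagonal_mul, mul_diagonal, add_mul, mul_comm (a j)]

/-- The map `D ↦ P (w ∘ Pᵀ D P) Pᵀ`, with `∘` the entrywise product, as a bilinear map of the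
weights `w` and of `D`. -/
def schurMultiplier (P : orthogonalGroup ι ℝ) : SymMat ι →L[ℝ] SymMat ι →L[ℝ] SymMat ι :=
  (LinearMap.mk₂ ℝ
    (fun w D => (coords P).symm (ofMatrix _ (isSymm_hadamard w (coords P D))))
    (fun w w' D => ext_coords P (by simp [add_hadamard]))
    (fun c w D => ext_coords P (by simp))
    (fun w D D' => ext_coords P (by simp [mul_add]))
    (fun c w D => ext_coords P (by simp))).toContinuousBilinearMap

@[simp] theorem toMatrix_coords_schurMultiplier (w D : SymMat ι) (i j : ι) :
    (coords P (schurMultiplier P w D)).toMatrix i j =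
      w.toMatrix i j * (coords P D).toMatrix i j := by
  change (coords P ((coords P).symm _)).toMatrix i j = _
  rw [LinearIsometryEquiv.apply_symm_apply]
  rfl

theorem schurMultiplier_entrywiseInv_of_mem_range {w Y : SymMat ι}
    (hY : Y ∈ Set.range (schurMultiplier P w)) :
    schurMultiplier P w (schurMultiplier P (entrywiseInv w) Y) = Y := by
  obtain ⟨D, rfl⟩ := hY
  refine ext_coords P fun i j => ?_
  simp only [toMatrix_coords_schurMultiplier, toMatrix_entrywiseInv, ← mul_assoc,
    mul_inv_mul_cancel]

theorem exists_coords_eq_diagonal (X : SymMat ι) :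
    ∃ (P : orthogonalGroup ι ℝ) (σ : ι → ℝ), coords P X = diagonal σ := by
  have hX := X.isHermitian_toMatrix
  refine ⟨hX.eigenvectorUnitary, hX.eigenvalues, coords_eq_iff.2 ?_⟩
  simpa [Unitary.conjStarAlgAut_apply, star_eq_conjTranspose,
    conjTranspose_eq_transpose_of_trivial] using hX.spectral_theorem

end SymMat

section EigWeight

variable {ι : Type*} {σ : ι → ℝ} {i j : ι}

theorem eigWeight_comm (σ : ι → ℝ) (i j : ι) : eigWeight σ j i = eigWeight σ i j := by
  simp only [eigWeight, add_comm]

theorem eigWeight_of_nonneg (hi : 0 ≤ σ i) (hj : 0 ≤ σ j) : eigWeight σ i j = 1 := by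
  unfold eigWeight
  split_ifs with h
  · rfl
  · rw [abs_of_nonneg hi, abs_of_nonneg hj] at h ⊢
    rw [max_eq_left hi, max_eq_left hj, div_self h]

theorem eigWeight_of_pos_of_neg (hi : 0 < σ i) (hj : σ j < 0) :
    eigWeight σ i j = σ i / (σ i - σ j) := by
  rw [eigWeight, abs_of_pos hi, abs_of_neg hj, if_neg (by linarith), max_eq_left hi.le,
    max_eq_right hj.le, add_zero, sub_eq_add_neg]

theorem eigWeight_of_nonpos_of_neg (hi : σ i ≤ 0) (hj : σ j < 0) : eigWeight σ i j = 0 := by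
  rw [eigWeight, abs_of_nonpos hi, abs_of_neg hj, if_neg (by linarith), max_eq_right hi,
    max_eq_right hj.le, add_zero, zero_div]

theorem mul_inv_eigWeight_mul_sub {s : ℝ} (hs : eigWeight σ i j = 0 → s = 0) :
    s * ((eigWeight σ i j)⁻¹ * s - s) =
      (if 0 < σ i ∧ σ j < 0 then -(σ j / σ i * s ^ 2) else 0) +
        if 0 < σ j ∧ σ i < 0 then -(σ i / σ j * s ^ 2) else 0 := by
  have hmixed {a b : ℝ} (ha : 0 < a) :
      s * ((a - b) / a * s - s) = -(b / a * s ^ 2) := by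
    field_simp
    ring
  rcases le_or_gt 0 (σ i) with hi | hi <;> rcases le_or_gt 0 (σ j) with hj | hj
  · rw [eigWeight_of_nonneg hi hj, if_neg (by simp [hj]), if_neg (by simp [hi])]
    ring
  · obtain hi | hi := hi.eq_or_lt
    · simp [hs (eigWeight_of_nonpos_of_neg hi.ge hj)]
    · rw [eigWeight_of_pos_of_neg hi hj, inv_div, hmixed hi, if_pos ⟨hi, hj⟩,
        if_neg (by simp [hi.le]), add_zero]
  · obtain hj | hj := hj.eq_or_lt
    · simp [hs ((eigWeight_comm σ j i).trans (eigWeight_of_nonpos_of_neg hj.ge hi))]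
    · rw [eigWeight_comm σ j i, eigWeight_of_pos_of_neg hj hi, inv_div, hmixed hj,
        if_neg (by simp [hi.le]), if_pos ⟨hj, hi⟩, zero_add]
  · simp [hs (eigWeight_of_nonpos_of_neg hi.le hj)]

theorem blockForm_apply (σ : ι → ℝ) (M : Matrix ι ι ℝ) (i j : ι) :
    blockForm σ M i j = eigWeight σ i j * M i j := by
  simp only [blockForm, Matrix.of_apply]
  split_ifs with hnonneg hsign
  · rw [eigWeight_of_nonneg hnonneg.1 hnonneg.2, one_mul]
  · rfl
  · rcases lt_or_ge (σ j) 0 with hj | hj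
    · rw [eigWeight_of_nonpos_of_neg (not_lt.1 fun hi => hsign (.inl ⟨hi, hj⟩)) hj, zero_mul]
    · have hi : σ i < 0 := not_le.1 fun hi => hnonneg ⟨hi, hj⟩
      rw [← eigWeight_comm,
        eigWeight_of_nonpos_of_neg (not_lt.1 fun hj => hsign (.inr ⟨hi, hj⟩)) hi, zero_mul]

theorem tendsto_ite_zero (s : ℝ) :
    Tendsto (fun t : ℝ => if s = 0 then t else s) (𝓝[>] 0) (𝓝 s) := by
  split_ifs with hs
  · exact hs ▸ tendsto_nhdsWithin_of_tendsto_nhds tendsto_id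
  · exact tendsto_const_nhds

theorem tendsto_eigWeight (σ : ι → ℝ) (i j : ι) :
    Tendsto (fun t : ℝ => eigWeight (fun k => if σ k = 0 then t else σ k) i j) (𝓝[>] 0)
      (𝓝 (eigWeight σ i j)) := by
  by_cases h : |σ i| + |σ j| = 0
  · obtain ⟨hi, hj⟩ := (add_eq_zero_iff_of_nonneg (abs_nonneg _) (abs_nonneg _)).1 h
    rw [abs_eq_zero] at hi hj
    refine tendsto_const_nhds.congr' ?_
    filter_upwards [self_mem_nhdsWithin] with t (ht : 0 < t)
    rw [eigWeight_of_nonneg hi.ge hj.ge, eigWeight_of_nonneg] <;> simp [hi, hj, ht.le]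
  · have hσ (k : ι) := tendsto_ite_zero (σ k)
    have hden := (hσ i).abs.add (hσ j).abs
    have hmax (k : ι) := (hσ k).max (tendsto_const_nhds (x := (0 : ℝ)))
    rw [eigWeight, if_neg h]
    refine (((hmax i).add (hmax j)).div hden h).congr' ?_
    filter_upwards [hden.eventually_ne h] with t ht
    exact (if_neg ht).symm

variable [Fintype ι]

/-- The matrix of the weights `eigWeight σ i j`, by which the greatest element of the limiting
Jacobian of the projection onto `psdCone ι` multiplies in an eigenbasis. -/
def eigWeights (σ : ι → ℝ) : SymMat ι :=
  .ofMatrix (.of (eigWeight σ)) (Matrix.ext (eigWeight_comm σ))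

@[simp] theorem toMatrix_eigWeights (σ : ι → ℝ) (i j : ι) :
    (eigWeights σ).toMatrix i j = eigWeight σ i j := rfl

end EigWeight

section PsdCone

open Matrix SymMat

variable {ι : Type*} [Fintype ι]

theorem psdCone_nonempty : (psdCone ι).Nonempty := ⟨0, PosSemidef.zero⟩

theorem isClosed_psdCone : IsClosed (psdCone ι) := by
  have mem_iff (X : SymMat ι) :
      X.toMatrix.PosSemidef ↔ ∀ v : ι → ℝ, 0 ≤ v ⬝ᵥ (X.toMatrix *ᵥ v) := by
    simp only [posSemidef_iff_dotProduct_mulVec, X.isHermitian_toMatrix, true_and, star_trivial]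
  simp only [psdCone, mem_iff, Set.ofPred_forall]
  exact isClosed_iInter fun v => isClosed_le continuous_const
    (continuous_const.dotProduct (continuous_toMatrix.matrix_mulVec continuous_const))

theorem convex_psdCone : Convex ℝ (psdCone ι) := fun _ hX _ hY _ _ ha hb _ =>
  (PosSemidef.smul hX ha).add (PosSemidef.smul hY hb)

theorem lipschitzWith_metricProj_psdCone : LipschitzWith 1 (metricProj (psdCone ι)) :=
  lipschitzWith_metricProj (E := SymMat ι) psdCone_nonempty isClosed_psdCone convex_psdCone

theorem limitingJacobian_metricProj_psdCone_subset_Icc (X : SymMat ι) :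
    limitingJacobian (metricProj (psdCone ι)) X ⊆ Set.Icc 0 1 :=
  limitingJacobian_metricProj_subset_Icc (E := SymMat ι) psdCone_nonempty isClosed_psdCone
    convex_psdCone X

variable [DecidableEq ι]

theorem diagonal_mem_psdCone {d : ι → ℝ} (hd : ∀ i, 0 ≤ d i) :
    SymMat.diagonal d ∈ psdCone ι := PosSemidef.diagonal hd

theorem coords_mem_psdCone_iff (P : orthogonalGroup ι ℝ) {X : SymMat ι} :
    coords P X ∈ psdCone ι ↔ X ∈ psdCone ι :=
  IsUnit.posSemidef_star_left_conjugate_iff (Unitary.toUnits P).isUnit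

theorem metricProj_psdCone_diagonal (σ : ι → ℝ) :
    metricProj (psdCone ι) (SymMat.diagonal σ) = SymMat.diagonal fun i => max (σ i) 0 := by
  have hmem : SymMat.diagonal (fun i => max (σ i) 0) ∈ psdCone ι :=
    diagonal_mem_psdCone fun i => le_max_right (σ i) 0
  refine metricProj_eq_of_inner_le_zero (E := SymMat ι) isClosed_psdCone convex_psdCone hmem
    fun Q (hQ : Q.toMatrix.PosSemidef) => ?_
  rw [inner_eq_sum]
  refine Finset.sum_nonpos fun i _ => ?_
  rw [Finset.sum_eq_single i (by simp +contextual [eq_comm]) (by simp)]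
  have hQi : 0 ≤ Q.toMatrix i i := hQ.diag_nonneg
  simp only [toMatrix_sub, toMatrix_diagonal, Matrix.sub_apply, Matrix.diagonal_apply_eq]
  rcases le_total (σ i) 0 with hi | hi
  · rw [max_eq_right hi]
    nlinarith
  · rw [max_eq_left hi, sub_self, zero_mul]

theorem metricProj_psdCone_coords (P : orthogonalGroup ι ℝ) (X : SymMat ι) :
    metricProj (psdCone ι) (coords P X) = coords P (metricProj (psdCone ι) X) := by
  have hpre : coords P ⁻¹' psdCone ι = psdCone ι :=
    Set.ext fun X => coords_mem_psdCone_iff P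
  have h := metricProj_linearIsometryEquiv_apply (E := SymMat ι) psdCone_nonempty isClosed_psdCone
    convex_psdCone (coords P) X
  rwa [hpre] at h

variable {P : orthogonalGroup ι ℝ} {X : SymMat ι} {σ : ι → ℝ}

theorem coords_metricProj_psdCone (hX : coords P X = SymMat.diagonal σ) :
    coords P (metricProj (psdCone ι) X) = SymMat.diagonal fun i => max (σ i) 0 := by
  rw [← metricProj_psdCone_coords, hX, metricProj_psdCone_diagonal]

theorem coords_two_nsmul_metricProj_psdCone_sub (hX : coords P X = SymMat.diagonal σ) :
    coords P (2 • metricProj (psdCone ι) X - X) = SymMat.diagonal fun i => |σ i| := by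
  have habs (s : ℝ) : max s 0 + max s 0 - s = |s| := by
    rcases le_total s 0 with hs | hs
    · simp [hs, abs_of_nonpos]
    · simp [hs, abs_of_nonneg]
  rw [map_sub, map_nsmul, coords_metricProj_psdCone hX, hX]
  refine toMatrix_injective ?_
  simp only [two_nsmul, toMatrix_sub, toMatrix_add, toMatrix_diagonal, Matrix.diagonal_add,
    Matrix.diagonal_sub, habs]

end PsdCone

section PsdConeJacobian

open Matrix SymMat

variable {ι : Type*} [Fintype ι]

theorem anticommutator_metricProj_psdCone (X : SymMat ι) :
    anticommutator (metricProj (psdCone ι) X) (metricProj (psdCone ι) X - X) = 0 := by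
  classical
  obtain ⟨P, σ, hX⟩ := exists_coords_eq_diagonal X
  have hpos := coords_metricProj_psdCone hX
  refine ext_coords P fun i j => ?_
  rw [toMatrix_coords_anticommutator hpos, map_sub, hpos, hX]
  obtain rfl | hij := eq_or_ne i j
  · rcases le_total (σ i) 0 with hi | hi <;> simp [hi]
  · simp [hij]

variable [DecidableEq ι] {P : orthogonalGroup ι ℝ} {X : SymMat ι} {σ : ι → ℝ}

theorem hasFDerivAt_metricProj_psdCone (hX : coords P X = SymMat.diagonal σ)
    (hσ : ∀ i, σ i ≠ 0) :
    HasFDerivAt (metricProj (psdCone ι)) (schurMultiplier P (eigWeights σ)) X := by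
  have habs := coords_two_nsmul_metricProj_psdCone_sub hX
  have hsum (i j : ι) : |σ i| + |σ j| ≠ 0 := by
    have := abs_pos.2 (hσ i)
    positivity
  have hinv : (schurMultiplier P (entrywiseInv (pairSums fun i => |σ i|))).comp
      (anticommutator (2 • metricProj (psdCone ι) X - X)) = .id ℝ (SymMat ι) := by
    refine ContinuousLinearMap.ext fun D => ext_coords P fun i j => ?_
    rw [ContinuousLinearMap.comp_apply, toMatrix_coords_schurMultiplier,
      toMatrix_coords_anticommutator habs, toMatrix_entrywiseInv, toMatrix_pairSums,
      inv_mul_cancel_left₀ (hsum i j), ContinuousLinearMap.id_apply]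
  have hcomp : (schurMultiplier P (entrywiseInv (pairSums fun i => |σ i|))).comp
      (anticommutator (metricProj (psdCone ι) X)) = schurMultiplier P (eigWeights σ) := by
    refine ContinuousLinearMap.ext fun D => ext_coords P fun i j => ?_
    rw [ContinuousLinearMap.comp_apply, toMatrix_coords_schurMultiplier,
      toMatrix_coords_schurMultiplier,
      toMatrix_coords_anticommutator (coords_metricProj_psdCone hX), toMatrix_entrywiseInv,
      toMatrix_pairSums, toMatrix_eigWeights, eigWeight, if_neg (hsum i j), div_eq_inv_mul,
      mul_assoc]
  have hderiv := hasFDerivAt_of_complementary (E := SymMat ι) anticommutator_comm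
    anticommutator_metricProj_psdCone lipschitzWith_metricProj_psdCone hinv
  rwa [hcomp] at hderiv

theorem schurMultiplier_mem_limitingJacobian (hX : coords P X = SymMat.diagonal σ) :
    schurMultiplier P (eigWeights σ) ∈ limitingJacobian (metricProj (psdCone ι)) X := by
  -- Zero eigenvalues are approached from above, so that the weights among them equal `1`.
  let σ' (t : ℝ) (i : ι) : ℝ := if σ i = 0 then t else σ i
  have hweights : Tendsto (fun t => eigWeights (σ' t)) (𝓝[>] 0) (𝓝 (eigWeights σ)) :=
    tendsto_iff_forall_toMatrix.2 (tendsto_eigWeight σ)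
  have hdiag : Tendsto (fun t => SymMat.diagonal (σ' t)) (𝓝[>] 0) (𝓝 (SymMat.diagonal σ)) := by
    refine tendsto_iff_forall_toMatrix.2 fun i j => ?_
    obtain rfl | hij := eq_or_ne i j
    · simpa [σ'] using tendsto_ite_zero (σ i)
    · simp [hij]
  have hcurve : Tendsto (fun t => (coords P).symm (SymMat.diagonal (σ' t))) (𝓝[>] 0) (𝓝 X) := by
    rw [← (coords P).symm_apply_apply X, hX]
    exact ((coords P).symm.continuous.tendsto _).comp hdiag
  refine mem_limitingJacobian_of_tendsto ?_ hcurve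
    (((schurMultiplier P).continuous.tendsto _).comp hweights)
  filter_upwards [self_mem_nhdsWithin] with t (ht : 0 < t)
  refine hasFDerivAt_metricProj_psdCone ((coords P).apply_symm_apply _) fun i => ?_
  by_cases hi : σ i = 0 <;> simp [σ', hi, ht.ne']

theorem isGreatest_limitingJacobian_metricProj_psdCone (hX : coords P X = SymMat.diagonal σ) :
    IsGreatest (limitingJacobian (metricProj (psdCone ι)) X)
      (schurMultiplier P (eigWeights σ)) := by
  refine isGreatest_limitingJacobian_of_complementary (E := SymMat ι) anticommutator_comm
    anticommutator_metricProj_psdCone lipschitzWith_metricProj_psdCone.continuous.continuousAt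
    (limitingJacobian_metricProj_psdCone_subset_Icc X)
    (schurMultiplier_mem_limitingJacobian hX) fun K hK => ext_coords P fun i j => ?_
  have hij : (|σ i| + |σ j|) * (coords P K).toMatrix i j = 0 := by
    rw [← toMatrix_coords_anticommutator (coords_two_nsmul_metricProj_psdCone_sub hX), hK,
      map_zero, toMatrix_zero, Matrix.zero_apply]
  rw [toMatrix_coords_schurMultiplier, toMatrix_eigWeights]
  rcases mul_eq_zero.1 hij with h | h
  · rw [eigWeight, if_pos h, one_mul]
  · rw [h, mul_zero]

end PsdConeJacobian

section PsdConeJacobianRange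

open Matrix SymMat

variable {ι : Type*} [Fintype ι]

theorem id_mem_limitingJacobian_metricProj_psdCone_zero :
    .id ℝ (SymMat ι) ∈ limitingJacobian (metricProj (psdCone ι)) 0 := by
  classical
  have hzero : coords (1 : orthogonalGroup ι ℝ) 0 = SymMat.diagonal 0 := by
    rw [map_zero]
    exact toMatrix_injective Matrix.diagonal_zero.symm
  convert schurMultiplier_mem_limitingJacobian hzero
  refine ContinuousLinearMap.ext fun D => ext_coords 1 fun i j => ?_
  rw [toMatrix_coords_schurMultiplier, toMatrix_eigWeights,
    eigWeight_of_nonneg (σ := 0) le_rfl le_rfl, one_mul, ContinuousLinearMap.id_apply]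

variable [DecidableEq ι]

theorem toMatrix_schurMultiplier_eigWeights (P : orthogonalGroup ι ℝ) (σ : ι → ℝ)
    (D : SymMat ι) : (schurMultiplier P (eigWeights σ) D).toMatrix =
      P * blockForm σ ((P : Matrix ι ι ℝ)ᵀ * D.toMatrix * P) * (P : Matrix ι ι ℝ)ᵀ := by
  have hblock : (coords P (schurMultiplier P (eigWeights σ) D)).toMatrix =
      blockForm σ (coords P D).toMatrix := Matrix.ext fun i j => by
    rw [toMatrix_coords_schurMultiplier, toMatrix_eigWeights, blockForm_apply]
  rw [← toMatrix_coords, ← hblock]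
  exact coords_eq_iff.1 rfl

variable {P : orthogonalGroup ι ℝ} {X Y : SymMat ι} {σ : ι → ℝ}

theorem jacobianRange_metricProj_psdCone (hX : coords P X = SymMat.diagonal σ) :
    jacobianRange (metricProj (psdCone ι)) X = Set.range (schurMultiplier P (eigWeights σ)) :=
  jacobianRange_eq_range_of_isGreatest
    ((limitingJacobian_metricProj_psdCone_subset_Icc X).trans Set.Icc_subset_Ici_self)
    (isGreatest_limitingJacobian_metricProj_psdCone hX)

theorem isLeast_jacobianPairings_metricProj_psdCone (hX : coords P X = SymMat.diagonal σ)
    (hY : Y ∈ Set.range (schurMultiplier P (eigWeights σ))) :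
    IsLeast (jacobianPairings (metricProj (psdCone ι)) X Y)
      (inner ℝ Y (schurMultiplier P (entrywiseInv (eigWeights σ)) Y - Y)) := by
  simpa only [schurMultiplier_entrywiseInv_of_mem_range hY] using
    isLeast_jacobianPairings_of_isGreatest
      ((limitingJacobian_metricProj_psdCone_subset_Icc X).trans Set.Icc_subset_Ici_self)
      (isGreatest_limitingJacobian_metricProj_psdCone hX)
      (schurMultiplier P (entrywiseInv (eigWeights σ)) Y)

theorem toMatrix_coords_schurMultiplier_inv_eigWeights_of_nonneg (P : orthogonalGroup ι ℝ)
    (Y : SymMat ι) {i j : ι} (hi : 0 ≤ σ i) (hj : 0 ≤ σ j) :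
    (coords P (schurMultiplier P (entrywiseInv (eigWeights σ)) Y)).toMatrix i j =
      (coords P Y).toMatrix i j := by
  rw [toMatrix_coords_schurMultiplier, toMatrix_entrywiseInv, toMatrix_eigWeights,
    eigWeight_of_nonneg hi hj, inv_one, one_mul]

theorem toMatrix_coords_schurMultiplier_inv_eigWeights_of_pos_of_neg (P : orthogonalGroup ι ℝ)
    (Y : SymMat ι) {i j : ι} (hi : 0 < σ i) (hj : σ j < 0) :
    (coords P (schurMultiplier P (entrywiseInv (eigWeights σ)) Y)).toMatrix i j =
      (σ i - σ j) / σ i * (coords P Y).toMatrix i j := by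
  rw [toMatrix_coords_schurMultiplier, toMatrix_entrywiseInv, toMatrix_eigWeights,
    eigWeight_of_pos_of_neg hi hj, inv_div]

theorem inner_schurMultiplier_inv_eigWeights_sub
    (hY : Y ∈ Set.range (schurMultiplier P (eigWeights σ))) :
    inner ℝ Y (schurMultiplier P (entrywiseInv (eigWeights σ)) Y - Y) =
      -2 * ∑ i with 0 < σ i, ∑ j with σ j < 0,
        σ j / σ i * (coords P Y).toMatrix i j ^ 2 := by
  set M := (coords P Y).toMatrix
  let q (i j : ι) : ℝ := if 0 < σ i ∧ σ j < 0 then -(σ j / σ i * M i j ^ 2) else 0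
  have hterm (i j : ι) : M i j * ((eigWeight σ i j)⁻¹ * M i j - M i j) = q i j + q j i := by
    have hM : eigWeight σ i j = 0 → M i j = 0 := by
      obtain ⟨D, rfl⟩ := hY
      intro h
      simp only [M, toMatrix_coords_schurMultiplier, toMatrix_eigWeights, h, zero_mul]
    have hsymm : M j i = M i j := (isSymm_toMatrix _).apply i j
    rw [mul_inv_eigWeight_mul_sub hM]
    simp only [q, hsymm]
  calc inner ℝ Y (schurMultiplier P (entrywiseInv (eigWeights σ)) Y - Y)
      = ∑ i, ∑ j, M i j * ((eigWeight σ i j)⁻¹ * M i j - M i j) := by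
        rw [← (coords P).inner_map_map, inner_eq_sum]
        simp only [map_sub, toMatrix_sub, Matrix.sub_apply, toMatrix_coords_schurMultiplier,
          toMatrix_entrywiseInv, toMatrix_eigWeights, M]
    _ = 2 * ∑ i, ∑ j, q i j := by
        simp only [hterm, Finset.sum_add_distrib]
        rw [Finset.sum_comm (f := fun i j => q j i), two_mul]
    _ = -2 * ∑ i with 0 < σ i, ∑ j with σ j < 0, σ j / σ i * M i j ^ 2 := by
        simp only [q, ite_and, Finset.sum_filter, Finset.sum_ite_irrel, Finset.sum_const_zero,
          Finset.mul_sum, mul_ite, mul_neg, neg_mul, mul_zero]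

end PsdConeJacobianRange

end

theorem mainTheorem5 (m : ℕ) (X U : SymMat (Fin m))
    (hX : X ∈ psdCone (Fin m)) (hU : U ∈ limitingNormalCone (psdCone (Fin m)) X) :
    JacobianRangeCondition (indicatorFun (psdCone (Fin m))) X U ∧
    ∀ (P : Matrix (Fin m) (Fin m) ℝ) (σ : Fin m → ℝ),
      P ∈ Matrix.orthogonalGroup (Fin m) ℝ →
      X.toMatrix + U.toMatrix = P * Matrix.diagonal σ * Pᵀ →
      -- the identity is an admissible choice of `Z` on the block of zero eigenvalues
      ContinuousLinearMap.id ℝ (SymMat {i : Fin m // σ i = 0}) ∈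
        limitingJacobian (metricProj (psdCone {i : Fin m // σ i = 0})) 0 ∧
      ∃ Wbar ∈ limitingJacobian (metricProj (psdCone (Fin m))) (X + U),
        (∀ D : SymMat (Fin m),
          (Wbar D).toMatrix = P * blockForm σ (Pᵀ * D.toMatrix * P) * Pᵀ) ∧
        {Y : SymMat (Fin m) | ∃ D : SymMat (Fin m),
            Y.toMatrix = P * blockForm σ (Pᵀ * D.toMatrix * P) * Pᵀ} =
          jacobianRange (metricProj (psdCone (Fin m))) (X + U) ∧
        jacobianRange (metricProj (psdCone (Fin m))) (X + U) = Set.range Wbar ∧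
        ∀ Y ∈ jacobianRange (metricProj (psdCone (Fin m))) (X + U),
          ∃ Dbar : SymMat (Fin m),
            (∀ i j, 0 ≤ σ i → 0 ≤ σ j →
              (Pᵀ * Dbar.toMatrix * P) i j = (Pᵀ * Y.toMatrix * P) i j) ∧
            (∀ i j, 0 < σ i → σ j < 0 →
              (Pᵀ * Dbar.toMatrix * P) i j =
                (σ i - σ j) / σ i * (Pᵀ * Y.toMatrix * P) i j ∧
              (Pᵀ * Dbar.toMatrix * P) j i =
                (σ i - σ j) / σ i * (Pᵀ * Y.toMatrix * P) i j) ∧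
            Y = Wbar Dbar ∧
            IsLeast (jacobianPairings (metricProj (psdCone (Fin m))) (X + U) Y)
              (inner ℝ Y (Dbar - Y)) ∧
            inner ℝ Y (Dbar - Y) =
              -2 * ∑ i with 0 < σ i, ∑ j with σ j < 0,
                σ j / σ i * (Pᵀ * Y.toMatrix * P) i j ^ 2 := by
  refine ⟨?_, fun P σ hP hXU => ?_⟩
  · obtain ⟨P, σ, hPσ⟩ := SymMat.exists_coords_eq_diagonal (X + U)
    exact jacobianRangeCondition_indicatorFun_of_isGreatest (E := SymMat (Fin m))
      isClosed_psdCone convex_psdCone hU (isGreatest_limitingJacobian_metricProj_psdCone hPσ)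
  lift P to Matrix.orthogonalGroup (Fin m) ℝ using hP
  have hPσ : SymMat.coords P (X + U) = SymMat.diagonal σ := SymMat.coords_eq_iff.2 hXU
  have hrange := jacobianRange_metricProj_psdCone hPσ
  have hblock := toMatrix_schurMultiplier_eigWeights P σ
  refine ⟨id_mem_limitingJacobian_metricProj_psdCone_zero, _,
    schurMultiplier_mem_limitingJacobian hPσ, hblock, ?_, hrange, fun Y hY => ?_⟩
  · rw [hrange]
    exact Set.ext fun Y => exists_congr fun D => by
      rw [← hblock, SymMat.toMatrix_injective.eq_iff, eq_comm]
  rw [hrange] at hY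
  have hsymm (D : SymMat (Fin m)) (i j : Fin m) :
      (SymMat.coords P D).toMatrix j i = (SymMat.coords P D).toMatrix i j :=
    (SymMat.isSymm_toMatrix _).apply i j
  have hmixed (i j : Fin m) (hi : 0 < σ i) (hj : σ j < 0) :=
    toMatrix_coords_schurMultiplier_inv_eigWeights_of_pos_of_neg P Y hi hj
  exact ⟨_, fun i j => toMatrix_coords_schurMultiplier_inv_eigWeights_of_nonneg P Y,
    fun i j hi hj => ⟨hmixed i j hi hj, (hsymm _ i j).trans (hmixed i j hi hj)⟩,
    (SymMat.schurMultiplier_entrywiseInv_of_mem_range hY).symm,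
    isLeast_jacobianPairings_metricProj_psdCone hPσ hY,
    inner_schurMultiplier_inv_eigWeights_sub hY⟩
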